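/- A semiring is a non-empty set with two associative binary operations $+$ and $\cdot$ such that $+$ is commutative and $\cdot$ distributes over $+$ from both sides (neither a zero nor a unity is required); a subsemiring is a non-empty subset closed under both operations. A semiring is congruence-simple if it has exactly two congruences, a congruence being an equivalence relation preserved by both operations. $\mathbf{M}_n(S)$ is the semiring of $n\times n$ matrices over $S$ with the usual addition and multiplication. For a finite lattice $L$ with $|L|\ge 2$, let $\mathrm{End}_0(L)$ be the set of all maps $f\colon L\to L$ that satisfy $f(x\vee y)=f(x)\vee f(y)$ for all $x,y\in L$ and fix the least element of $L$. It is a semiring $(\mathrm{End}_0(L),\vee,\circ)$ under $(f\vee g)(x)=f(x)\vee g(x)$ and $(f\circ g)(x)=f(g(x))$. Let $X(L)=\{f\in\mathrm{End}_0(L) : |f(L)|\le 2\}$. Theorem. Let $S$ be a finite semiring with $a+a=a$ for all $a\in S$, and let $n\ge 2$. Then $\mathbf{M}_n(S)$ is congruence-simple if and only if there are a finite lattice $L$ with $|L|\ge 2$ and a subsemiring $R$ of $(\mathrm{End}_0(L),\vee,\circ)$ with $X(L)\subseteq R$ such that $S\cong R$. -/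

import Mathlib

/-- A semiring in the sense used here: two associative operations, `+` commutative, and `*`
distributing over `+` on both sides. Neither a zero nor a unity is required. (Nonemptiness is
a separate instance argument in the theorem.) -/
class PlainSemiring (S : Type*) extends AddCommSemigroup S, Semigroup S, Distrib S

/-- `S` is congruence-simple if it has exactly two congruences. -/
def IsCongruenceSimple (S : Type*) [PlainSemiring S] : Prop :=
  Nat.card (RingCon S) = 2

/-- A subsemiring: a nonempty subset closed under both operations. -/
structure PlainSubsemiring (T : Type*) [PlainSemiring T] where
  carrier : Set T
  nonempty' : carrier.Nonempty
  add_mem' : ∀ {a b : T}, a ∈ carrier → b ∈ carrier → a + b ∈ carrier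
  mul_mem' : ∀ {a b : T}, a ∈ carrier → b ∈ carrier → a * b ∈ carrier

namespace PlainSubsemiring

variable {T : Type*} [PlainSemiring T]

instance : SetLike (PlainSubsemiring T) T where
  coe R := R.carrier
  coe_injective R R' h := by cases R; cases R'; congr

/-- A subsemiring carries the restricted addition. -/
instance : AddMemClass (PlainSubsemiring T) T where
  add_mem {R} := R.add_mem'

/-- A subsemiring carries the restricted multiplication. -/
instance : MulMemClass (PlainSubsemiring T) T where
  mul_mem {R} := R.mul_mem'

end PlainSubsemiring

/-! ### Square matrices -/

/-- The sum `f 0 + f 1 + ⋯ + f m` of a nonempty finite family (no zero element is needed). -/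
def finSum {S : Type*} [Add S] : {m : ℕ} → (Fin (m + 1) → S) → S
  | 0, f => f 0
  | _ + 1, f => finSum (fun i => f i.castSucc) + f (Fin.last _)

section FinSum

variable {S : Type*} [PlainSemiring S]

theorem finSum_add {m : ℕ} (f g : Fin (m + 1) → S) :
    finSum (fun i => f i + g i) = finSum f + finSum g := by
  induction m with
  | zero => rfl
  | succ m ih => simp only [finSum, ih]; exact add_add_add_comm _ _ _ _

theorem finSum_mul {m : ℕ} (f : Fin (m + 1) → S) (c : S) :
    finSum f * c = finSum (fun i => f i * c) := by
  induction m with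
  | zero => rfl
  | succ m ih => simp only [finSum, add_mul, ih]

theorem mul_finSum {m : ℕ} (f : Fin (m + 1) → S) (c : S) :
    c * finSum f = finSum (fun i => c * f i) := by
  induction m with
  | zero => rfl
  | succ m ih => simp only [finSum, mul_add, ih]

theorem finSum_comm {m k : ℕ} (f : Fin (m + 1) → Fin (k + 1) → S) :
    finSum (fun i => finSum (fun j => f i j)) = finSum (fun j => finSum (fun i => f i j)) := by
  induction m with
  | zero => rfl
  | succ m ih => simp only [finSum, ih, finSum_add]

end FinSum

/-- The type of `n × n` matrices over `S`. -/
def SqMat (n : ℕ) (S : Type*) : Type _ := Fin n → Fin n → S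

namespace SqMat

variable {S : Type*} [PlainSemiring S]

/-- Entrywise addition. -/
instance (n : ℕ) : Add (SqMat n S) := ⟨fun A B i j => A i j + B i j⟩

/-- The usual product, with `(i, j)` entry the sum of all `A i k * B k j`. -/
def mul : {n : ℕ} → SqMat n S → SqMat n S → SqMat n S
  | 0, _, _ => fun i => i.elim0
  | _ + 1, A, B => fun i j => finSum (fun k => A i k * B k j)

instance (n : ℕ) : Mul (SqMat n S) := ⟨mul⟩

/-- The semiring of `n × n` matrices over a semiring. -/
instance (n : ℕ) : PlainSemiring (SqMat n S) where
  add_assoc A B C := funext fun i => funext fun j => add_assoc (A i j) (B i j) (C i j)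
  add_comm A B := funext fun i => funext fun j => add_comm (A i j) (B i j)
  mul_assoc A B C := by
    cases n with
    | zero => exact funext fun i => i.elim0
    | succ n =>
      funext i j
      change finSum (fun k => finSum (fun l => A i l * B l k) * C k j)
        = finSum (fun l => A i l * finSum (fun k => B l k * C k j))
      simp only [finSum_mul, mul_finSum, mul_assoc]
      exact finSum_comm _
  left_distrib A B C := by
    cases n with
    | zero => exact funext fun i => i.elim0
    | succ n =>
      funext i j
      change finSum (fun k => A i k * (B k j + C k j))
        = finSum (fun k => A i k * B k j) + finSum (fun k => A i k * C k j)
      simp only [mul_add, finSum_add]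
  right_distrib A B C := by
    cases n with
    | zero => exact funext fun i => i.elim0
    | succ n =>
      funext i j
      change finSum (fun k => (A i k + B i k) * C k j)
        = finSum (fun k => A i k * C k j) + finSum (fun k => B i k * C k j)
      simp only [add_mul, finSum_add]

end SqMat

/-! ### The semiring of join-morphisms preserving the least element -/

/-- `End₀(L)`: the maps `L → L` that preserve binary joins and the least element. -/
def EndBot (L : Type*) [Lattice L] [OrderBot L] : Type _ := SupBotHom L L

namespace EndBot

variable {L : Type*} [Lattice L] [OrderBot L]

instance : FunLike (EndBot L) L L := inferInstanceAs (FunLike (SupBotHom L L) L L)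

/-- Addition is the pointwise join. -/
instance : Add (EndBot L) := ⟨fun f g => max (α := SupBotHom L L) f g⟩

/-- Multiplication is composition. -/
instance : Mul (EndBot L) := ⟨fun f g => SupBotHom.comp f g⟩

theorem add_apply (f g : EndBot L) (x : L) : (f + g) x = f x ⊔ g x := rfl

theorem mul_apply (f g : EndBot L) (x : L) : (f * g) x = f (g x) := rfl

/-- The semiring `(End₀(L), ∨, ∘)`. -/
instance : PlainSemiring (EndBot L) where
  add_assoc f g h := DFunLike.ext _ _ fun x => sup_assoc (f x) (g x) (h x)
  add_comm f g := DFunLike.ext _ _ fun x => sup_comm (f x) (g x)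
  mul_assoc _ _ _ := rfl
  left_distrib f g h := DFunLike.ext _ _ fun x => (SupBotHom.toSupHom f).map_sup' (g x) (h x)
  right_distrib _ _ _ := rfl

/-- `X(L)`: the members of `End₀(L)` whose image has at most two elements. -/
def smallImage (L : Type*) [Lattice L] [OrderBot L] : Set (EndBot L) :=
  {f | (Set.range f).encard ≤ 2}

end EndBot

/-!
If `S` acts densely on a finite lattice `L`, then `M_n(S)` acts densely on `L ^ n`, because the step
map of `L ^ n` that sends the elements below `a` to `⊥` and all others to `b` is the matrix of the
step maps for the pairs `(a j, b i)`. Density forces congruence-simplicity: two elements acting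
differently can be multiplied on both sides by step maps so as to become the greatest and the least
element of `End₀(L)`, and adding these to any element shows that it is congruent to the greatest.

Conversely, let `M_n(S)` be congruence-simple. Then so is `S`, and every matrix lies above a product
`B * C`, hence above the outer product of a column of `B` and a row of `C`. If `S` has `p` minimal
elements, then each of the `p ^ 4` matrices of size two with minimal entries thus arises from one of
the `p ^ 4` choices of two pairs of minimal elements. The choice is therefore unique, which for
constant matrices gives `p ^ 2 ≤ p`, and `S` has a least element. It is absorbing because the matrix
`⊤` and the matrix obtained from it by lowering one entry to `⊥` have the same products with `⊥`.
Finally, let `S * x` be a nonzero left ideal whose elements have the fewest distinct left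
annihilators. The lattice of these annihilators carries a dense action of `S`, since endomorphisms
that act transitively on nonzero points and separate points generate all step maps.
-/

/-! ### Homomorphisms and congruences -/

namespace PlainSemiring

/-- A homomorphism of plain semirings, preserving both operations. It plays the role of
`NonUnitalRingHom`, which is not available because it asks for zeros. -/
structure Hom (S T : Type*) [Add S] [Mul S] [Add T] [Mul T] extends AddHom S T, MulHom S T

namespace Hom

section Basic

variable {S T U : Type*} [Add S] [Mul S] [Add T] [Mul T] [Add U] [Mul U]

instance : FunLike (Hom S T) S T where
  coe φ := φ.toFun
  coe_injective := by
    rintro ⟨⟨f, _⟩, _⟩ ⟨⟨g, _⟩, _⟩ h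
    congr

instance : AddHomClass (Hom S T) S T where
  map_add φ := φ.map_add'

instance : MulHomClass (Hom S T) S T where
  map_mul φ := φ.map_mul'

/-- Composition of homomorphisms of plain semirings. -/
def comp (ψ : Hom T U) (φ : Hom S T) : Hom S U where
  toFun := ψ ∘ φ
  map_add' a b := by simp only [Function.comp_apply, map_add]
  map_mul' a b := by simp only [Function.comp_apply, map_mul]

theorem comp_apply (ψ : Hom T U) (φ : Hom S T) (s : S) : ψ.comp φ s = ψ (φ s) := rfl

end Basic

/-- The range of a homomorphism, as a subsemiring. -/
def range {S T : Type*} [Nonempty S] [Add S] [Mul S] [PlainSemiring T] (φ : Hom S T) :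
    PlainSubsemiring T where
  carrier := Set.range φ
  nonempty' := Set.range_nonempty φ
  add_mem' := by
    rintro _ _ ⟨a, rfl⟩ ⟨b, rfl⟩
    exact ⟨a + b, map_add φ a b⟩
  mul_mem' := by
    rintro _ _ ⟨a, rfl⟩ ⟨b, rfl⟩
    exact ⟨a * b, map_mul φ a b⟩

end Hom

section Congruences

variable {S : Type*} [PlainSemiring S]

/-- The congruence identifying two elements that act in the same way, by left multiplication, on
a set `X` closed under left multiplication. -/
def leftKernel (X : Set S) (hX : ∀ a, ∀ x ∈ X, a * x ∈ X) : RingCon S where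
  r a b := ∀ x ∈ X, a * x = b * x
  iseqv := ⟨fun _ _ _ => rfl, fun h x hx => (h x hx).symm, fun h h' x hx =>
    (h x hx).trans (h' x hx)⟩
  add' h h' x hx := by rw [add_mul, add_mul, h x hx, h' x hx]
  mul' {a b c d} h h' x hx := by
    rw [mul_assoc, mul_assoc, h _ (hX c x hx), h' x hx]

/-- The congruence identifying two elements that act in the same way, by right multiplication, on
a set `X` closed under right multiplication. -/
def rightKernel (X : Set S) (hX : ∀ a, ∀ x ∈ X, x * a ∈ X) : RingCon S where
  r a b := ∀ x ∈ X, x * a = x * b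
  iseqv := ⟨fun _ _ _ => rfl, fun h x hx => (h x hx).symm, fun h h' x hx =>
    (h x hx).trans (h' x hx)⟩
  add' h h' x hx := by rw [mul_add, mul_add, h x hx, h' x hx]
  mul' {a b c d} h h' x hx := by
    rw [← mul_assoc, ← mul_assoc, h x hx, h' _ (hX b x hx)]

/-- The Rees congruence collapsing to a point a set `I` that is an ideal of both the additive
and the multiplicative semigroup. -/
def reesCon (I : Set S) (add_mem : ∀ a ∈ I, ∀ b, a + b ∈ I)
    (mul_mem_right : ∀ a ∈ I, ∀ b, a * b ∈ I) (mul_mem_left : ∀ a, ∀ b ∈ I, a * b ∈ I) :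
    RingCon S where
  r a b := a = b ∨ a ∈ I ∧ b ∈ I
  iseqv := ⟨fun _ => Or.inl rfl, by grind, by grind⟩
  add' := by
    have add_mem' (a b : S) (hb : b ∈ I) : a + b ∈ I := add_comm b a ▸ add_mem b hb a
    grind
  mul' := by grind

end Congruences

end PlainSemiring

theorem isCongruenceSimple_iff {S : Type*} [PlainSemiring S] :
    IsCongruenceSimple S ↔
      Nontrivial S ∧ ∀ c : RingCon S, (∀ a b, c a b → a = b) ∨ ∀ a b, c a b := by
  have eq_bot_iff (c : RingCon S) : c = ⊥ ↔ ∀ a b, c a b → a = b := by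
    rw [← le_bot_iff]; exact Iff.rfl
  have eq_top_iff (c : RingCon S) : c = ⊤ ↔ ∀ a b, c a b := by
    rw [← top_le_iff]; exact ⟨fun h a b => h trivial, fun h a b _ => h a b⟩
  simp only [← eq_bot_iff, ← eq_top_iff]
  rw [IsCongruenceSimple, Nat.card_eq_two_iff' ⊥]
  constructor
  · rintro ⟨d, hd, hd'⟩
    refine ⟨RingCon.nontrivial_iff.1 ⟨d, ⊥, hd⟩, fun c => or_iff_not_imp_left.2 fun hc => ?_⟩
    have htop : ⊤ = d := hd' ⊤ fun h => hd (le_bot_iff.1 (h ▸ le_top))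
    exact (hd' c hc).trans htop.symm
  · rintro ⟨hS, h⟩
    have := RingCon.nontrivial_iff.2 hS
    exact ⟨⊤, top_ne_bot, fun c hc => (h c).resolve_left hc⟩

namespace IsCongruenceSimple

variable {S : Type*} [PlainSemiring S]

theorem nontrivial (hS : IsCongruenceSimple S) : Nontrivial S :=
  (isCongruenceSimple_iff.1 hS).1

theorem eq_or_forall (hS : IsCongruenceSimple S) (c : RingCon S) :
    (∀ a b, c a b → a = b) ∨ ∀ a b, c a b :=
  (isCongruenceSimple_iff.1 hS).2 c

theorem injective_of_ne {T : Type*} [Add T] [Mul T] (hS : IsCongruenceSimple S)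
    (φ : PlainSemiring.Hom S T) {a b : S} (hab : φ a ≠ φ b) : Function.Injective φ := by
  rcases hS.eq_or_forall (RingCon.comap ⊥ φ) with h | h
  · exact h
  · exact absurd (h a b) hab

theorem eq_of_forall_mul_eq (hS : IsCongruenceSimple S) (hmul : ∃ s a b : S, s * a ≠ s * b)
    {a b : S} (hab : ∀ s, s * a = s * b) : a = b := by
  rcases hS.eq_or_forall (PlainSemiring.rightKernel Set.univ fun _ _ _ => Set.mem_univ _) with
    h | h
  · exact h a b fun s _ => hab s
  · obtain ⟨s, a, b, hs⟩ := hmul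
    exact absurd (h a b s (Set.mem_univ s)) hs

end IsCongruenceSimple

/-! ### Endomorphisms with small image -/

namespace EndBot

section Basic

variable {L : Type*} [Lattice L] [OrderBot L]

instance : SupBotHomClass (EndBot L) L L := inferInstanceAs (SupBotHomClass (SupBotHom L L) L L)

@[ext]
theorem ext {f g : EndBot L} (h : ∀ x, f x = g x) : f = g := DFunLike.ext f g h

theorem mono (f : EndBot L) : Monotone f := OrderHomClass.mono f

/-- The endomorphism with underlying map `f`. -/
def mk (f : L → L) (map_sup : ∀ x y, f (x ⊔ y) = f x ⊔ f y) (map_bot : f ⊥ = ⊥) : EndBot L :=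
  (⟨⟨f, map_sup⟩, map_bot⟩ : SupBotHom L L)

theorem mk_apply (f : L → L) (map_sup : ∀ x y, f (x ⊔ y) = f x ⊔ f y) (map_bot : f ⊥ = ⊥)
    (x : L) : mk f map_sup map_bot x = f x := rfl

open Classical in
/-- The endomorphism sending the elements below `a` to `⊥` and all others to `b`. These are the
members of `X(L)`. -/
noncomputable def step (a b : L) : EndBot L :=
  mk (fun x => if x ≤ a then ⊥ else b)
    (fun x y => by by_cases hx : x ≤ a <;> by_cases hy : y ≤ a <;> simp [hx, hy])
    (if_pos bot_le)

theorem step_of_le {a x : L} (b : L) (h : x ≤ a) : step a b x = ⊥ := if_pos h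

theorem step_of_not_le {a x : L} (b : L) (h : ¬x ≤ a) : step a b x = b := if_neg h

theorem step_apply_le (a b x : L) : step a b x ≤ b := by
  by_cases h : x ≤ a
  · exact (step_of_le b h).trans_le bot_le
  · exact (step_of_not_le b h).le

theorem mul_step (f : EndBot L) (a b : L) : f * step a b = step a (f b) := by
  ext x
  rw [mul_apply]
  by_cases h : x ≤ a
  · rw [step_of_le _ h, step_of_le _ h, map_bot]
  · rw [step_of_not_le _ h, step_of_not_le _ h]

theorem add_step_bot (f : EndBot L) (a : L) : f + step a ⊥ = f := by
  ext x
  rw [add_apply, le_bot_iff.1 (step_apply_le a ⊥ x), sup_bot_eq]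

theorem add_step_bot_top [OrderTop L] (f : EndBot L) : f + step ⊥ ⊤ = step ⊥ ⊤ := by
  ext x
  rw [add_apply]
  by_cases h : x ≤ ⊥
  · rw [le_bot_iff.1 h, map_bot, map_bot, sup_idem]
  · rw [step_of_not_le _ h, sup_top_eq]

theorem step_mem_smallImage (a b : L) : step a b ∈ smallImage L := by
  have hrange : Set.range (step a b) ⊆ {⊥, b} := by
    rintro _ ⟨x, rfl⟩
    by_cases h : x ≤ a
    · exact Or.inl (step_of_le b h)
    · exact Or.inr (step_of_not_le b h)
  exact (Set.encard_le_encard hrange).trans <|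
    (Set.encard_insert_le _ _).trans <| by
      rw [Set.encard_singleton]; exact one_add_one_eq_two.le

theorem eq_bot_or_eq_top_of_mem_smallImage [OrderTop L] {f : EndBot L} (hf : f ∈ smallImage L)
    (x : L) : f x = ⊥ ∨ f x = f ⊤ := by
  by_contra! h
  have hsub : {⊥, f ⊤, f x} ⊆ Set.range f := by
    rintro _ (rfl | rfl | rfl)
    exacts [⟨⊥, map_bot f⟩, ⟨⊤, rfl⟩, ⟨x, rfl⟩]
  have htop : f ⊤ ≠ ⊥ := fun htop => h.1 (le_bot_iff.1 (htop ▸ f.mono le_top))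
  have hcard : ({⊥, f ⊤, f x} : Set L).encard = 3 :=
    Set.encard_eq_three.2 ⟨_, _, _, htop.symm, h.1.symm, h.2.symm, rfl⟩
  have : (3 : ℕ∞) ≤ 2 := hcard ▸ (Set.encard_le_encard hsub).trans hf
  exact absurd this (by decide)

theorem exists_isGreatest_ker [Finite L] (f : EndBot L) : ∃ a, IsGreatest {x | f x = ⊥} a := by
  obtain ⟨a, ha, hmax⟩ := (Set.toFinite {x | f x = ⊥}).exists_maximal ⟨⊥, map_bot f⟩
  refine ⟨a, ha, fun x hx => le_sup_right.trans (hmax (y := a ⊔ x) ?_ le_sup_left)⟩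
  change f (a ⊔ x) = ⊥
  rw [map_sup, show f a = ⊥ from ha, show f x = ⊥ from hx, sup_idem]

theorem exists_eq_step [Finite L] {f : EndBot L} (hf : f ∈ smallImage L) :
    ∃ a b, f = step a b := by
  cases nonempty_fintype L
  let := Fintype.toOrderTop L
  obtain ⟨a, ha, hmax⟩ := f.exists_isGreatest_ker
  refine ⟨a, f ⊤, ext fun x => ?_⟩
  by_cases h : x ≤ a
  · rw [step_of_le _ h]
    exact le_bot_iff.1 ((f.mono h).trans_eq ha)
  · rw [step_of_not_le _ h]
    exact (eq_bot_or_eq_top_of_mem_smallImage hf x).resolve_left fun hx => h (hmax hx)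

end Basic

section Density

variable {L : Type*} [Lattice L] [OrderBot L] [Finite L] [Nontrivial L]
  {R : PlainSubsemiring (EndBot L)}

theorem step_top_mem_of_transitive_of_separating [OrderTop L]
    (htrans : ∀ x ≠ ⊥, ∀ y, ∃ f ∈ R, f x = y)
    (hsep : ∀ x y, ¬x ≤ y → ∃ f ∈ R, f y = ⊥ ∧ f x ≠ ⊥) (a : L) : step a ⊤ ∈ R := by
  have hfin : Finite (EndBot L) := DFunLike.finite _
  obtain ⟨z, hzR, hz⟩ := htrans ⊤ (fun h => isBot_bot.not_isTop (h ▸ isTop_top)) ⊥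
  have hza : z a = ⊥ := le_bot_iff.1 ((z.mono le_top).trans_eq hz)
  obtain ⟨f, ⟨hfR, hfa⟩, hmax⟩ := Set.Finite.exists_maximalFor (fun f : EndBot L => (f : L → L))
    {f | f ∈ R ∧ f a = ⊥} (Set.toFinite _) ⟨z, hzR, hza⟩
  -- If `f y` were smaller than `⊤`, then `f + h * g` below would contradict maximality.
  have hf (y : L) (hy : ¬y ≤ a) : f y = ⊤ := by
    obtain ⟨g, hgR, hga, hgy⟩ := hsep y a hy
    obtain ⟨h, hhR, hhy⟩ := htrans (g y) hgy ⊤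
    have hmem : f + h * g ∈ R ∧ (f + h * g) a = ⊥ :=
      ⟨add_mem hfR (mul_mem hhR hgR), by
        rw [add_apply, mul_apply, hfa, hga, map_bot, sup_idem]⟩
    have hle : (f + h * g) y ≤ f y := hmax hmem (fun _ => le_sup_left) y
    rwa [add_apply, mul_apply, hhy, sup_top_eq, top_le_iff] at hle
  suffices f = step a ⊤ from this ▸ hfR
  ext x
  by_cases h : x ≤ a
  · rw [step_of_le _ h]
    exact le_bot_iff.1 ((f.mono h).trans_eq hfa)
  · rw [step_of_not_le _ h, hf x h]

theorem smallImage_subset_of_transitive_of_separating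
    (htrans : ∀ x ≠ ⊥, ∀ y, ∃ f ∈ R, f x = y)
    (hsep : ∀ x y, ¬x ≤ y → ∃ f ∈ R, f y = ⊥ ∧ f x ≠ ⊥) : smallImage L ⊆ R := by
  intro f hf
  cases nonempty_fintype L
  let := Fintype.toOrderTop L
  obtain ⟨a, b, rfl⟩ := exists_eq_step hf
  obtain ⟨g, hgR, hg⟩ := htrans ⊤ (fun h => isBot_bot.not_isTop (h ▸ isTop_top)) b
  have hgstep : g * step a ⊤ = step a b := by rw [mul_step, hg]
  rw [← hgstep]
  exact mul_mem hgR (step_top_mem_of_transitive_of_separating htrans hsep a)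

end Density

/-- A dense representation of a semiring on a lattice `L`: a faithful representation by elements
of `End₀(L)` whose range contains `X(L)`. -/
structure IsDenseRep {S L : Type*} [Add S] [Mul S] [Lattice L] [OrderBot L]
    (φ : PlainSemiring.Hom S (EndBot L)) : Prop where
  injective : Function.Injective φ
  smallImage_subset : smallImage L ⊆ Set.range φ

namespace IsDenseRep

section Simplicity

variable {S L : Type*} [PlainSemiring S] [Lattice L] [OrderBot L]
  {φ : PlainSemiring.Hom S (EndBot L)}

theorem exists_eq_step (hφ : IsDenseRep φ) (a b : L) : ∃ s, φ s = step a b :=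
  hφ.smallImage_subset (step_mem_smallImage a b)

theorem con_of_not_le [OrderTop L] (hφ : IsDenseRep φ) (c : RingCon S) {s t : S} (hst : c s t)
    {x : L} (hx : ¬φ s x ≤ φ t x) {u v : S} (hu : φ u = step ⊥ ⊤) (hv : φ v = step ⊥ ⊥) :
    c u v := by
  obtain ⟨p, hp⟩ := hφ.exists_eq_step (φ t x) ⊤
  obtain ⟨q, hq⟩ := hφ.exists_eq_step ⊥ x
  have hφpq (r : S) : φ (p * (r * q)) = step ⊥ (step (φ t x) ⊤ (φ r x)) := by
    rw [map_mul, map_mul, hp, hq, mul_step, mul_step]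
  have hs : p * (s * q) = u := hφ.injective <| by rw [hφpq, step_of_not_le _ hx, hu]
  have ht : p * (t * q) = v := hφ.injective <| by rw [hφpq, step_of_le _ le_rfl, hv]
  exact hs ▸ ht ▸ c.mul (c.refl p) (c.mul hst (c.refl q))

theorem isCongruenceSimple [Finite L] [Nontrivial L] (hφ : IsDenseRep φ) :
    IsCongruenceSimple S := by
  cases nonempty_fintype L
  let := Fintype.toOrderTop L
  obtain ⟨u, hu⟩ := hφ.exists_eq_step ⊥ ⊤
  obtain ⟨v, hv⟩ := hφ.exists_eq_step ⊥ ⊥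
  refine isCongruenceSimple_iff.2 ⟨⟨u, v, fun huv => ?_⟩, fun c => ?_⟩
  · have htop : (⊤ : L) ≤ ⊥ := calc
      ⊤ = step ⊥ ⊤ ⊤ := (step_of_not_le _ fun h => isBot_bot.not_isTop (isTop_top.mono h)).symm
      _ = step ⊥ ⊥ ⊤ := by rw [← hu, ← hv, huv]
      _ ≤ ⊥ := step_apply_le _ _ _
    exact isBot_bot.not_isTop (isTop_top.mono htop)
  · by_cases hc : ∃ s t, c s t ∧ ∃ x, ¬φ s x ≤ φ t x
    · obtain ⟨s, t, hst, x, hx⟩ := hc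
      have huv : c u v := hφ.con_of_not_le c hst hx hu hv
      have hall (r : S) : c u r := by
        have hru : r + u = u := hφ.injective <| by rw [map_add, hu, add_step_bot_top]
        have hrv : r + v = r := hφ.injective <| by rw [map_add, hv, add_step_bot]
        simpa only [hru, hrv] using c.add (c.refl r) huv
      exact Or.inr fun a b => c.trans (c.symm (hall a)) (hall b)
    · push Not at hc
      exact Or.inl fun s t hst => hφ.injective <| ext fun x =>
        le_antisymm (hc s t hst x) (hc t s (c.symm hst) x)

end Simplicity

theorem exists_iff_exists_subsemiring {S L : Type*} [PlainSemiring S] [Nonempty S] [Lattice L]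
    [OrderBot L] :
    (∃ φ : PlainSemiring.Hom S (EndBot L), IsDenseRep φ) ↔
      ∃ R : PlainSubsemiring (EndBot L), smallImage L ⊆ R ∧ Nonempty (S ≃+* R) := by
  constructor
  · rintro ⟨φ, hφ⟩
    exact ⟨φ.range, hφ.smallImage_subset,
      ⟨{ Equiv.ofInjective φ hφ.injective with
          map_mul' := fun a b => Subtype.ext (map_mul φ a b)
          map_add' := fun a b => Subtype.ext (map_add φ a b) }⟩⟩
  · rintro ⟨R, hR, ⟨e⟩⟩
    refine ⟨⟨⟨fun s => e s, fun a b => ?_⟩, fun a b => ?_⟩, ?_, fun f hf => ?_⟩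
    · exact congrArg Subtype.val (map_add e a b)
    · exact congrArg Subtype.val (map_mul e a b)
    · exact Subtype.val_injective.comp e.injective
    · exact ⟨e.symm ⟨f, hR hf⟩, congrArg Subtype.val (e.apply_symm_apply _)⟩

end IsDenseRep

end EndBot

/-! ### Matrices over a dense representation -/

section FinSum

theorem map_finSum {F S T : Type*} [Add S] [Add T] [FunLike F S T] [AddHomClass F S T] (φ : F)
    {m : ℕ} (f : Fin (m + 1) → S) : φ (finSum f) = finSum fun k => φ (f k) := by
  induction m with
  | zero => rfl
  | succ m ih => rw [finSum, map_add, ih, finSum]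

theorem map_finSum_le_iff {S L : Type*} [Add S] [SemilatticeSup L] {φ : S → L}
    (hφ : ∀ a b, φ (a + b) = φ a ⊔ φ b) {m : ℕ} {f : Fin (m + 1) → S} {y : L} :
    φ (finSum f) ≤ y ↔ ∀ k, φ (f k) ≤ y := by
  induction m with
  | zero => rw [Fin.forall_fin_one, finSum]
  | succ m ih =>
    rw [finSum, hφ, sup_le_iff, ih]
    exact (Fin.forall_fin_succ' (P := fun k => φ (f k) ≤ y)).symm

theorem EndBot.finSum_apply_le_iff {L : Type*} [Lattice L] [OrderBot L] {m : ℕ}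
    {f : Fin (m + 1) → EndBot L} {x y : L} : finSum f x ≤ y ↔ ∀ k, f k x ≤ y :=
  map_finSum_le_iff (φ := fun g : EndBot L => g x) fun g h => EndBot.add_apply g h x

end FinSum

namespace SqMat

/-- The matrix with entries `f i j`. -/
def of {S : Type*} {n : ℕ} (f : Fin n → Fin n → S) : SqMat n S := f

theorem mul_apply {S : Type*} [PlainSemiring S] {m : ℕ} (A B : SqMat (m + 1) S)
    (i j : Fin (m + 1)) : (A * B) i j = finSum fun k => A i k * B k j := rfl

end SqMat

/-- The homomorphism of matrix semirings obtained by applying `φ` to every entry. -/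
def PlainSemiring.Hom.mapMatrix {S T : Type*} [PlainSemiring S] [PlainSemiring T]
    (φ : PlainSemiring.Hom S T) (m : ℕ) :
    PlainSemiring.Hom (SqMat (m + 1) S) (SqMat (m + 1) T) where
  toFun A := SqMat.of fun i j => φ (A i j)
  map_add' A B := funext fun i => funext fun j => map_add φ (A i j) (B i j)
  map_mul' A B := funext fun i => funext fun j => by
    rw [SqMat.mul_apply]
    exact (map_finSum φ _).trans (congrArg finSum (funext fun k => map_mul φ (A i k) (B k j)))

namespace SqMat

section ToEndBot

variable {L : Type*} [Lattice L] [OrderBot L] {m : ℕ}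

/-- A matrix over `End₀(L)` acts on column vectors over `L`. -/
def toEndBot : PlainSemiring.Hom (SqMat (m + 1) (EndBot L)) (EndBot (Fin (m + 1) → L)) where
  toFun A := EndBot.mk (fun x i => Finset.univ.sup fun j => A i j (x j))
    (fun x y => funext fun i => by
      simp only [Pi.sup_apply, map_sup]
      exact Finset.sup_sup)
    (funext fun i => by simp only [Pi.bot_apply, map_bot, Finset.sup_bot])
  map_add' A B := EndBot.ext fun x => funext fun i =>
    Finset.sup_sup (s := Finset.univ) (f := fun j => A i j (x j)) (g := fun j => B i j (x j))
  map_mul' A B := EndBot.ext fun x => funext fun i => eq_of_forall_ge_iff fun y => by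
    simp only [EndBot.mul_apply, EndBot.mk_apply, map_finset_sup, Finset.sup_le_iff,
      Finset.mem_univ, true_imp_iff, Function.comp_apply]
    simp only [SqMat.mul_apply, EndBot.finSum_apply_le_iff, EndBot.mul_apply]
    exact forall_comm

theorem toEndBot_apply (A : SqMat (m + 1) (EndBot L)) (x : Fin (m + 1) → L) (i : Fin (m + 1)) :
    toEndBot A x i = Finset.univ.sup fun j => A i j (x j) := rfl

theorem toEndBot_apply_update_bot (A : SqMat (m + 1) (EndBot L)) (i j : Fin (m + 1)) (x : L) :
    toEndBot A (Function.update ⊥ j x) i = A i j x := by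
  rw [toEndBot_apply]
  apply le_antisymm
  · refine Finset.sup_le fun k _ => ?_
    rcases eq_or_ne k j with rfl | hk
    · rw [Function.update_self]
    · rw [Function.update_of_ne hk, Pi.bot_apply, map_bot]
      exact bot_le
  · have hj : Function.update (⊥ : Fin (m + 1) → L) j x j = x := Function.update_self ..
    calc A i j x = A i j (Function.update (⊥ : Fin (m + 1) → L) j x j) := by rw [hj]
      _ ≤ _ := Finset.le_sup (f := fun k => A i k (Function.update (⊥ : Fin (m + 1) → L) j x k))
        (Finset.mem_univ j)

theorem toEndBot_injective : Function.Injective (toEndBot (L := L) (m := m)) := by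
  intro A B h
  funext i j
  ext x
  rw [← toEndBot_apply_update_bot, h, toEndBot_apply_update_bot]

theorem toEndBot_step (a b : Fin (m + 1) → L) :
    toEndBot (of fun i j => EndBot.step (a j) (b i)) = EndBot.step a b := by
  refine EndBot.ext fun x => funext fun i => ?_
  rw [toEndBot_apply]
  by_cases hx : x ≤ a
  · rw [EndBot.step_of_le b hx]
    exact (Finset.sup_eq_bot_iff _ _).2 fun j _ => EndBot.step_of_le _ (hx j)
  · rw [EndBot.step_of_not_le b hx]
    obtain ⟨j, hj⟩ := not_forall.1 hx
    refine le_antisymm (Finset.sup_le fun j _ => EndBot.step_apply_le _ _ _) ?_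
    calc b i = EndBot.step (a j) (b i) (x j) := (EndBot.step_of_not_le _ hj).symm
      _ ≤ _ := Finset.le_sup (f := fun j => EndBot.step (a j) (b i) (x j)) (Finset.mem_univ j)

end ToEndBot

end SqMat

theorem EndBot.IsDenseRep.mapMatrix {S L : Type*} [PlainSemiring S] [Lattice L] [OrderBot L]
    [Finite L] {φ : PlainSemiring.Hom S (EndBot L)} (hφ : IsDenseRep φ) (m : ℕ) :
    IsDenseRep (SqMat.toEndBot.comp (φ.mapMatrix m)) where
  injective A B h := by
    have hAB : φ.mapMatrix m A = φ.mapMatrix m B := SqMat.toEndBot_injective h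
    exact funext fun i => funext fun j => hφ.injective (congrFun (congrFun hAB i) j)
  smallImage_subset f hf := by
    obtain ⟨a, b, rfl⟩ := EndBot.exists_eq_step hf
    choose s hs using hφ.exists_eq_step
    refine ⟨SqMat.of fun i j => s (a j) (b i), ?_⟩
    have hA : φ.mapMatrix m (SqMat.of fun i j => s (a j) (b i)) =
        SqMat.of fun i j => step (a j) (b i) := funext fun i => funext fun j => hs _ _
    rw [PlainSemiring.Hom.comp_apply, hA, SqMat.toEndBot_step]

/-! ### Semirings whose addition is the join -/

/-- The addition of the semiring `S` is the join of its order, as in `IdemSemiring`. -/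
class AddEqSup (S : Type*) [PlainSemiring S] [SemilatticeSup S] : Prop where
  add_eq_sup : ∀ a b : S, a + b = a ⊔ b

/-- The least element of `S` annihilates `S` from both sides. As it is neutral for joins, this says
that it is a zero of a semiring satisfying `AddEqSup`. -/
class AbsorbingBot (S : Type*) [Mul S] [Bot S] : Prop where
  mul_bot : ∀ a : S, a * ⊥ = ⊥
  bot_mul : ∀ a : S, ⊥ * a = ⊥

/-- The order of a semiring with idempotent addition: `a ≤ b` means `a + b = b`. -/
abbrev PlainSemiring.semilatticeSup {S : Type*} [PlainSemiring S] (h : ∀ a : S, a + a = a) :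
    SemilatticeSup S :=
  let : Max S := ⟨fun a b => a + b⟩
  SemilatticeSup.mk' add_comm add_assoc h

namespace AddEqSup

variable {S : Type*} [PlainSemiring S] [SemilatticeSup S] [AddEqSup S]

instance : MulLeftMono S where
  elim a b c h := by
    change a * b ≤ a * c
    rw [← sup_eq_right, ← add_eq_sup, ← mul_add, add_eq_sup, sup_eq_right.2 h]

instance : MulRightMono S where
  elim a b c h := by
    change b * a ≤ c * a
    rw [← sup_eq_right, ← add_eq_sup, ← add_mul, add_eq_sup, sup_eq_right.2 h]

end AddEqSup

namespace IsCongruenceSimple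

variable {M : Type*} [PlainSemiring M]

theorem injective_of_forall_mul_eq {T : Type*} [Add T] (hM : IsCongruenceSimple M)
    (hmul : ∀ a b c d : M, a * b = c * d) (f : M →ₙ+ T) {a b : M} (hab : f a ≠ f b) :
    Function.Injective f :=
  -- As all products coincide, `f` is a homomorphism for a constant multiplication on `T`.
  let : Mul T := ⟨fun _ _ => f (a * a)⟩
  let φ : PlainSemiring.Hom M T := { f with map_mul' := fun c d => congrArg f (hmul c d a a) }
  hM.injective_of_ne φ hab

section Ordered

variable [SemilatticeSup M] [AddEqSup M]

theorem exists_mul_le (hM : IsCongruenceSimple M) (hmul : ∃ a b c d : M, a * b ≠ c * d) (x : M) :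
    ∃ a b, a * b ≤ x := by
  let I : Set M := {x | ∃ a b, a * b ≤ x}
  have hI (a b : M) : a * b ∈ I := ⟨a, b, le_rfl⟩
  have add_mem (a : M) (ha : a ∈ I) (b : M) : a + b ∈ I := by
    obtain ⟨p, q, hpq⟩ := ha
    exact ⟨p, q, hpq.trans (le_sup_left.trans_eq (AddEqSup.add_eq_sup a b).symm)⟩
  rcases hM.eq_or_forall
    (PlainSemiring.reesCon I add_mem (fun a _ b => hI a b) (fun a b _ => hI a b)) with h | h
  · obtain ⟨a, b, c, d, hne⟩ := hmul
    exact absurd (h _ _ (Or.inr ⟨hI a b, hI c d⟩)) hne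
  · rcases h x (x * x) with hx | hx
    · exact hx ▸ hI x x
    · exact hx.1

variable [OrderBot M]

theorem bot_mul_bot (hM : IsCongruenceSimple M) (hmul : ∃ a b c d : M, a * b ≠ c * d) :
    (⊥ : M) * ⊥ = ⊥ := by
  obtain ⟨a, b, hab⟩ := hM.exists_mul_le hmul ⊥
  exact le_bot_iff.1 ((mul_le_mul' bot_le bot_le).trans hab)

variable [OrderTop M]

theorem mul_bot_of_ne_top (hM : IsCongruenceSimple M) (hbot : (⊥ : M) * ⊥ = ⊥) {b : M}
    (hb : b ≠ ⊤) (hmul : b * ⊥ = ⊤ * ⊥) (a : M) : a * ⊥ = ⊥ := by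
  -- `b` and `⊤` act alike on the left ideal `M * ⊥`, so by simplicity all elements do.
  rcases hM.eq_or_forall (PlainSemiring.leftKernel (Set.range (· * ⊥))
    (by rintro a _ ⟨c, rfl⟩; exact ⟨a * c, mul_assoc a c ⊥⟩)) with h | h
  · refine absurd (h b ⊤ ?_) hb
    rintro _ ⟨c, rfl⟩
    refine le_antisymm (mul_le_mul' le_top le_rfl) ?_
    calc ⊤ * (c * ⊥) = ⊤ * c * ⊥ := (mul_assoc _ _ _).symm
      _ ≤ ⊤ * ⊥ := mul_le_mul' le_top le_rfl
      _ = b * ⊥ := hmul.symm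
      _ ≤ b * (c * ⊥) := mul_le_mul' le_rfl bot_le
  · exact (h a ⊥ ⊥ ⟨⊥, hbot⟩).trans hbot

theorem bot_mul_of_ne_top (hM : IsCongruenceSimple M) (hbot : (⊥ : M) * ⊥ = ⊥) {b : M}
    (hb : b ≠ ⊤) (hmul : ⊥ * b = ⊥ * ⊤) (a : M) : ⊥ * a = ⊥ := by
  rcases hM.eq_or_forall (PlainSemiring.rightKernel (Set.range (⊥ * ·))
    (by rintro a _ ⟨c, rfl⟩; exact ⟨c * a, (mul_assoc ⊥ c a).symm⟩)) with h | h
  · refine absurd (h b ⊤ ?_) hb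
    rintro _ ⟨c, rfl⟩
    refine le_antisymm (mul_le_mul' le_rfl le_top) ?_
    calc ⊥ * c * ⊤ = ⊥ * (c * ⊤) := mul_assoc _ _ _
      _ ≤ ⊥ * ⊤ := mul_le_mul' le_rfl le_top
      _ = ⊥ * b := hmul.symm
      _ ≤ ⊥ * c * b := mul_le_mul' bot_le le_rfl
  · exact (h a ⊥ ⊥ ⟨⊥, hbot⟩).trans hbot

end Ordered

end IsCongruenceSimple

/-! ### Semirings with congruence-simple matrix semirings -/

namespace SqMat

variable {S : Type*} [PlainSemiring S]

/-- The matrix with all entries equal to `a`. -/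
def const {S : Type*} {n : ℕ} (a : S) : SqMat n S := of fun _ _ => a

theorem const_injective {S : Type*} {m : ℕ} :
    Function.Injective (const : S → SqMat (m + 1) S) :=
  fun _ _ h => congrFun (congrFun h 0) 0

/-- The entrywise extension of a congruence to matrices. -/
def entrywiseCon (c : RingCon S) (m : ℕ) : RingCon (SqMat (m + 1) S) where
  r A B := ∀ i j, c (A i j) (B i j)
  iseqv := ⟨fun A i j => c.refl _, fun h i j => c.symm (h i j), fun h h' i j =>
    c.trans (h i j) (h' i j)⟩
  add' h h' i j := c.add (h i j) (h' i j)
  mul' {A B C D} h h' i j := by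
    have rel_finSum {k : ℕ} (f g : Fin (k + 1) → S) (hfg : ∀ l, c (f l) (g l)) :
        c (finSum f) (finSum g) := by
      induction k with
      | zero => exact hfg 0
      | succ k ih => exact c.add (ih _ _ fun l => hfg _) (hfg _)
    exact rel_finSum _ _ fun l => c.mul (h i l) (h' l j)

theorem isCongruenceSimple_entries {m : ℕ} (h : IsCongruenceSimple (SqMat (m + 1) S)) :
    IsCongruenceSimple S := by
  refine isCongruenceSimple_iff.2 ⟨?_, fun c => ?_⟩
  · obtain ⟨A, B, hAB⟩ := h.nontrivial
    by_contra! hS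
    exact hAB (funext fun i => funext fun j => Subsingleton.elim _ _)
  · refine (h.eq_or_forall (entrywiseCon c m)).imp (fun h a b hab => ?_) (fun h a b => ?_)
    · exact const_injective (h (const a) (const b) fun _ _ => hab)
    · exact h (const a) (const b) 0 0

theorem exists_mul_ne {m : ℕ} (h : IsCongruenceSimple (SqMat (m + 2) S)) :
    ∃ A B C D : SqMat (m + 2) S, A * B ≠ C * D := by
  obtain ⟨a, b, hab⟩ := (isCongruenceSimple_entries h).nontrivial
  by_contra! hmul
  let entry : SqMat (m + 2) S →ₙ+ S := ⟨fun A => A 0 0, fun _ _ => rfl⟩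
  have hentry : Function.Injective entry :=
    h.injective_of_forall_mul_eq hmul entry (a := const a) (b := const b) hab
  have hA : (of fun i _ => if i = 0 then a else b : SqMat (m + 2) S) = const a := hentry rfl
  exact hab (congrFun (congrFun hA 1) 0).symm

section Order

variable [SemilatticeSup S] {n m : ℕ}

instance : SemilatticeSup (SqMat n S) := inferInstanceAs (SemilatticeSup (Fin n → Fin n → S))

instance [OrderBot S] : OrderBot (SqMat n S) := inferInstanceAs (OrderBot (Fin n → Fin n → S))

instance [OrderTop S] : OrderTop (SqMat n S) := inferInstanceAs (OrderTop (Fin n → Fin n → S))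

variable [AddEqSup S]

instance : AddEqSup (SqMat n S) :=
  ⟨fun A B => funext fun i => funext fun j => AddEqSup.add_eq_sup (A i j) (B i j)⟩

theorem mul_apply_le_iff {A B : SqMat (m + 1) S} {i j : Fin (m + 1)} {y : S} :
    (A * B) i j ≤ y ↔ ∀ k, A i k * B k j ≤ y :=
  map_finSum_le_iff (φ := id) AddEqSup.add_eq_sup

theorem entry_mul_entry_le (A B : SqMat (m + 1) S) (i k j : Fin (m + 1)) :
    A i k * B k j ≤ (A * B) i j :=
  mul_apply_le_iff.1 le_rfl k

end Order

end SqMat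

theorem exists_isMin_le {α : Type*} [PartialOrder α] [Finite α] (a : α) : ∃ p ≤ a, IsMin p := by
  obtain ⟨p, hpa, hp⟩ := exists_minimal_le_of_wellFoundedLT (fun _ : α => True) a trivial
  exact ⟨p, hpa, minimal_true.1 hp⟩

theorem subsingleton_of_surjective_outer {P : Type*} [Finite P] (f : P → P → P)
    (hf : Function.Surjective fun (w : (Fin 2 → P) × (Fin 2 → P)) (i j : Fin 2) =>
      f (w.1 i) (w.2 j)) : Subsingleton P := by
  have houter := (Finite.injective_iff_surjective_of_equiv (finTwoArrowEquiv (Fin 2 → P)).symm).2 hf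
  have hinj : Function.Injective (Function.uncurry f) := by
    rintro ⟨p, q⟩ ⟨p', q'⟩ h
    have hconst := @houter (fun _ => p, fun _ => q) (fun _ => p', fun _ => q')
      (funext fun _ => funext fun _ => h)
    exact Prod.ext (congrFun (congrArg Prod.fst hconst) 0) (congrFun (congrArg Prod.snd hconst) 0)
  have hcard := Nat.card_le_card_of_injective _ hinj
  rw [Nat.card_prod] at hcard
  rw [← Finite.card_le_one_iff_subsingleton]
  nlinarith

namespace SqMat

section Consequences

variable {S : Type*} [PlainSemiring S] [SemilatticeSup S] [AddEqSup S] {m : ℕ}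

theorem subsingleton_isMin [Finite S] (h : IsCongruenceSimple (SqMat (m + 2) S)) :
    Subsingleton {p : S // IsMin p} := by
  choose μ hμ hμmin using exists_isMin_le (α := S)
  refine subsingleton_of_surjective_outer (fun p q => ⟨μ (p * q), hμmin _⟩) fun A => ?_
  let r : Fin 2 → Fin (m + 2) := Fin.castLE (Nat.le_add_left 2 m)
  have hr : Function.Injective r := Fin.castLE_injective _
  let s : Fin (m + 2) → Fin 2 := Function.invFun r
  have hsr (i : Fin 2) : s (r i) = i := Function.leftInverse_invFun hr i
  obtain ⟨B, C, hBC⟩ := h.exists_mul_le (exists_mul_ne h) (of fun i j => (A (s i) (s j) : S))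
  refine ⟨(fun i => ⟨μ (B (r i) 0), hμmin _⟩, fun j => ⟨μ (C 0 (r j)), hμmin _⟩),
    funext fun i => funext fun j => ?_⟩
  refine Subtype.ext ((A i j).2.eq_of_le ?_)
  calc μ (μ (B (r i) 0) * μ (C 0 (r j)))
    _ ≤ μ (B (r i) 0) * μ (C 0 (r j)) := hμ _
    _ ≤ B (r i) 0 * C 0 (r j) := mul_le_mul' (hμ _) (hμ _)
    _ ≤ (B * C) (r i) (r j) := entry_mul_entry_le B C _ _ _
    _ ≤ A (s (r i)) (s (r j)) := hBC (r i) (r j)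
    _ = A i j := by rw [hsr, hsr]

theorem exists_isBot [Finite S] (h : IsCongruenceSimple (SqMat (m + 2) S)) : ∃ z : S, IsBot z := by
  have hsub := subsingleton_isMin h
  obtain ⟨a, -⟩ := (isCongruenceSimple_entries h).nontrivial
  obtain ⟨z, -, hz⟩ := exists_isMin_le a
  refine ⟨z, fun b => ?_⟩
  obtain ⟨p, hpb, hp⟩ := exists_isMin_le b
  have hzp : (⟨z, hz⟩ : {p : S // IsMin p}) = ⟨p, hp⟩ := Subsingleton.elim _ _
  exact (congrArg Subtype.val hzp).trans_le hpb

variable [OrderBot S]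

theorem exists_mul_ne_bot (h : IsCongruenceSimple (SqMat (m + 2) S)) :
    ∃ a b : S, a * b ≠ ⊥ := by
  by_contra! hmul
  have hbot (A B : SqMat (m + 2) S) : A * B = ⊥ :=
    le_bot_iff.1 fun i j => mul_apply_le_iff.2 fun k => (hmul (A i k) (B k j)).le
  obtain ⟨A, B, C, D, hne⟩ := exists_mul_ne h
  exact hne ((hbot A B).trans (hbot C D).symm)

theorem exists_ne_top_mul_bot_eq [OrderTop S] [Nontrivial S] :
    ∃ B : SqMat (m + 2) S, B ≠ ⊤ ∧ B * ⊥ = ⊤ * ⊥ ∧ ⊥ * B = ⊥ * ⊤ := by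
  let B : SqMat (m + 2) S := of fun i j => if i = 0 ∧ j = 0 then ⊥ else ⊤
  have hrow (i : Fin (m + 2)) : B i 1 = ⊤ := by simp [B, of]
  have hcol (j : Fin (m + 2)) : B 1 j = ⊤ := by simp [B, of]
  refine ⟨B, fun hB => ?_, le_antisymm (mul_le_mul' le_top le_rfl) fun i j => ?_,
    le_antisymm (mul_le_mul' le_rfl le_top) fun i j => ?_⟩
  · have hbot : (⊥ : S) = ⊤ := congrFun (congrFun hB 0) 0
    exact isBot_bot.not_isTop (hbot ▸ isTop_top)
  · refine mul_apply_le_iff.2 fun _ => ?_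
    calc (⊤ : S) * ⊥ = B i 1 * ⊥ := by rw [hrow]
      _ ≤ (B * ⊥) i j := entry_mul_entry_le B ⊥ i 1 j
  · refine mul_apply_le_iff.2 fun _ => ?_
    calc (⊥ : S) * ⊤ = ⊥ * B 1 j := by rw [hcol]
      _ ≤ (⊥ * B) i j := entry_mul_entry_le ⊥ B i 1 j

theorem absorbingBot [Finite S] (h : IsCongruenceSimple (SqMat (m + 2) S)) : AbsorbingBot S := by
  cases nonempty_fintype S
  let := Fintype.toOrderTop S
  have := (isCongruenceSimple_entries h).nontrivial
  have hbot := h.bot_mul_bot (exists_mul_ne h)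
  obtain ⟨B, hB, hmul_bot, hbot_mul⟩ := exists_ne_top_mul_bot_eq (S := S) (m := m)
  refine ⟨fun a => le_bot_iff.1 ?_, fun a => le_bot_iff.1 ?_⟩
  · calc a * ⊥ ≤ (const a * ⊥ : SqMat (m + 2) S) 0 0 := entry_mul_entry_le (const a) ⊥ 0 0 0
      _ = ⊥ := by rw [h.mul_bot_of_ne_top hbot hB hmul_bot]; rfl
  · calc ⊥ * a ≤ (⊥ * const a : SqMat (m + 2) S) 0 0 := entry_mul_entry_le ⊥ (const a) 0 0 0
      _ = ⊥ := by rw [h.bot_mul_of_ne_top hbot hB hbot_mul]; rfl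

end Consequences

end SqMat

/-! ### The action on annihilators -/

/-- A finite join-semilattice with a least element is a lattice: the meet of two elements is the
join of their common lower bounds. -/
noncomputable abbrev latticeOfFinite (L : Type*) [SemilatticeSup L] [OrderBot L] [Finite L] :
    Lattice L where
  inf a b := (Set.toFinite {c | c ≤ a ∧ c ≤ b}).toFinset.sup id
  inf_le_left _ _ := Finset.sup_le fun _ hc => ((Set.Finite.mem_toFinset _).1 hc).1
  inf_le_right _ _ := Finset.sup_le fun _ hc => ((Set.Finite.mem_toFinset _).1 hc).2
  le_inf _ _ _ hab hac := Finset.le_sup (f := id) ((Set.Finite.mem_toFinset _).2 ⟨hab, hac⟩)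

universe u w

namespace PlainSemiring

section LeftAnn

variable {S : Type u} [PlainSemiring S] [Bot S] [Small.{w} S]

/-- The left annihilator of `x`, as a set ordered by reverse inclusion so that `leftAnn` is
monotone. Indexing by `Shrink S` places it in an arbitrary universe. -/
noncomputable def leftAnn (x : S) : (Set (Shrink.{w} S))ᵒᵈ :=
  OrderDual.toDual {t | (equivShrink S).symm t * x = ⊥}

/-- The map on reversely ordered sets that takes the left annihilator of `x` to that of `s * x`. -/
noncomputable def shift (s : S) (A : (Set (Shrink.{w} S))ᵒᵈ) : (Set (Shrink.{w} S))ᵒᵈ :=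
  OrderDual.toDual
    ((fun t => equivShrink S ((equivShrink S).symm t * s)) ⁻¹' OrderDual.ofDual A)

theorem leftAnn_le_leftAnn {x y : S} :
    leftAnn.{u, w} x ≤ leftAnn y ↔ ∀ t, t * y = ⊥ → t * x = ⊥ :=
  (equivShrink S).symm.forall_congr_right (q := fun t => t * y = ⊥ → t * x = ⊥)

theorem shift_leftAnn (s x : S) : shift s (leftAnn.{u, w} x) = leftAnn (s * x) := by
  refine congrArg OrderDual.toDual (Set.ext fun t => ?_)
  change (equivShrink S).symm (equivShrink S _) * x = ⊥ ↔ (equivShrink S).symm t * (s * x) = ⊥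
  rw [Equiv.symm_apply_apply, mul_assoc]

end LeftAnn

section Annihilation

variable {S : Type u} [PlainSemiring S] [SemilatticeSup S] [AddEqSup S] [OrderBot S]

theorem add_eq_bot_iff {a b : S} : a + b = ⊥ ↔ a = ⊥ ∧ b = ⊥ := by
  rw [AddEqSup.add_eq_sup, sup_eq_bot_iff]

variable [Small.{w} S]

theorem leftAnn_add (x y : S) : leftAnn.{u, w} (x + y) = leftAnn x ⊔ leftAnn y := by
  refine congrArg OrderDual.toDual (Set.ext fun t => ?_)
  change (equivShrink S).symm t * (x + y) = ⊥ ↔ _ ∧ _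
  rw [mul_add, add_eq_bot_iff]
  exact Iff.rfl

end Annihilation

/-- The annihilators of the elements of the left ideal `S * x`. On a minimal left ideal they form
the lattice on which a congruence-simple semiring is represented. -/
def AnnOrbit {S : Type u} [PlainSemiring S] [Bot S] [Small.{w} S] (x : S) : Type w :=
  {A : (Set (Shrink.{w} S))ᵒᵈ // A ∈ Set.range fun s => leftAnn.{u, w} (s * x)}

namespace AnnOrbit

section Orbit

variable {S : Type u} [PlainSemiring S] [Bot S] [Small.{w} S] {x : S}

/-- The annihilator of `s * x`, as an element of `AnnOrbit x`. -/
noncomputable def mk (x s : S) : AnnOrbit.{u, w} x := ⟨leftAnn (s * x), s, rfl⟩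

theorem mk_surjective : Function.Surjective (mk.{u, w} x) := by
  rintro ⟨_, s, rfl⟩
  exact ⟨s, rfl⟩

instance [Finite S] : Finite (AnnOrbit.{u, w} x) := Finite.of_surjective _ mk_surjective

end Orbit

section Order

variable {S : Type u} [PlainSemiring S] [SemilatticeSup S] [AddEqSup S] [OrderBot S]
  [Small.{w} S] {x : S}

noncomputable instance : SemilatticeSup (AnnOrbit.{u, w} x) :=
  Subtype.semilatticeSup <| by
    rintro _ _ ⟨s, rfl⟩ ⟨t, rfl⟩
    exact ⟨s + t, (congrArg leftAnn (add_mul s t x)).trans (leftAnn_add _ _)⟩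

theorem mk_le_mk {s t : S} :
    mk.{u, w} x s ≤ mk x t ↔ ∀ r, r * (t * x) = ⊥ → r * (s * x) = ⊥ :=
  leftAnn_le_leftAnn

variable [AbsorbingBot S]

noncomputable instance : OrderBot (AnnOrbit.{u, w} x) where
  bot := mk x ⊥
  bot_le A := by
    obtain ⟨s, rfl⟩ := mk_surjective A
    exact mk_le_mk.2 fun r _ => by rw [AbsorbingBot.bot_mul, AbsorbingBot.mul_bot]

theorem mk_bot : mk.{u, w} x ⊥ = ⊥ := rfl

theorem mk_eq_bot_iff (hfaith : ∀ y : S, (∀ s, s * y = ⊥) → y = ⊥) {s : S} :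
    mk.{u, w} x s = ⊥ ↔ s * x = ⊥ := by
  rw [← le_bot_iff, ← mk_bot, mk_le_mk]
  refine ⟨fun h => hfaith _ fun r => h r ?_, fun h r _ => ?_⟩
  · rw [AbsorbingBot.bot_mul, AbsorbingBot.mul_bot]
  · rw [h, AbsorbingBot.mul_bot]

theorem nontrivial (hfaith : ∀ y : S, (∀ s, s * y = ⊥) → y = ⊥) (hx : x ≠ ⊥) :
    Nontrivial (AnnOrbit.{u, w} x) := by
  obtain ⟨s, hs⟩ := not_forall.1 (mt (hfaith x) hx)
  exact ⟨mk x s, ⊥, (mk_eq_bot_iff hfaith).not.2 hs⟩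

variable [Finite S]

noncomputable instance : Lattice (AnnOrbit.{u, w} x) := latticeOfFinite _

/-- The representation of `S` on the lattice `AnnOrbit x` by left multiplication. -/
noncomputable def rep (x : S) : Hom S (EndBot (AnnOrbit.{u, w} x)) where
  toFun s := EndBot.mk
    (fun A => ⟨shift s A.1, by
      obtain ⟨t, ht⟩ := A.2
      refine ⟨s * t, ?_⟩
      rw [← ht]
      exact (congrArg leftAnn (mul_assoc s t x)).trans (shift_leftAnn s (t * x)).symm⟩)
    (fun A B => rfl)
    (Subtype.ext <| by
      change shift s (leftAnn (⊥ * x)) = leftAnn (⊥ * x)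
      rw [shift_leftAnn, AbsorbingBot.bot_mul, AbsorbingBot.mul_bot])
  map_add' s t := EndBot.ext fun A => by
    obtain ⟨r, rfl⟩ := mk_surjective A
    refine Subtype.ext ?_
    change shift (s + t) (leftAnn _) = shift s (leftAnn _) ⊔ shift t (leftAnn _)
    rw [shift_leftAnn, shift_leftAnn, shift_leftAnn, add_mul, leftAnn_add]
  map_mul' s t := EndBot.ext fun A => by
    obtain ⟨r, rfl⟩ := mk_surjective A
    refine Subtype.ext ?_
    change shift (s * t) (leftAnn _) = shift s (shift t (leftAnn _))
    rw [shift_leftAnn, shift_leftAnn, shift_leftAnn, mul_assoc]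

theorem rep_mk (s t : S) : rep.{u, w} x s (mk x t) = mk x (s * t) :=
  Subtype.ext ((shift_leftAnn s (t * x)).trans (congrArg leftAnn (mul_assoc s t x).symm))

theorem exists_rep_eq_bot_of_not_le (hfaith : ∀ y : S, (∀ s, s * y = ⊥) → y = ⊥)
    {A B : AnnOrbit.{u, w} x} (hAB : ¬A ≤ B) : ∃ s, rep x s B = ⊥ ∧ rep x s A ≠ ⊥ := by
  obtain ⟨a, rfl⟩ := mk_surjective A
  obtain ⟨b, rfl⟩ := mk_surjective B
  obtain ⟨s, hsb, hsa⟩ : ∃ s, s * (b * x) = ⊥ ∧ s * (a * x) ≠ ⊥ := by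
    simpa only [mk_le_mk, not_forall, exists_prop] using hAB
  refine ⟨s, ?_, ?_⟩
  · rwa [rep_mk, mk_eq_bot_iff hfaith, mul_assoc]
  · rwa [rep_mk, Ne, mk_eq_bot_iff hfaith, mul_assoc]

theorem exists_rep_eq_of_ncard_le (hfaith : ∀ y : S, (∀ s, s * y = ⊥) → y = ⊥)
    (hmin : ∀ y : S, y ≠ ⊥ → (Set.range fun s => leftAnn.{u, w} (s * x)).ncard ≤
      (Set.range fun s => leftAnn.{u, w} (s * y)).ncard)
    {A : AnnOrbit.{u, w} x} (hA : A ≠ ⊥) (B : AnnOrbit.{u, w} x) : ∃ s, rep x s A = B := by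
  obtain ⟨a, rfl⟩ := mk_surjective A
  have hsub : (Set.range fun s => leftAnn.{u, w} (s * (a * x))) ⊆
      Set.range fun s => leftAnn (s * x) := by
    rintro _ ⟨s, rfl⟩
    exact ⟨s * a, congrArg leftAnn (mul_assoc s a x)⟩
  have heq := Set.eq_of_subset_of_ncard_le hsub
    (hmin (a * x) fun h => hA ((mk_eq_bot_iff hfaith).2 h)) (Set.toFinite _)
  obtain ⟨s, hs⟩ : B.1 ∈ Set.range fun s => leftAnn (s * (a * x)) := heq.symm.subset B.2
  exact ⟨s, (rep_mk s a).trans (Subtype.ext ((congrArg leftAnn (mul_assoc s a x)).trans hs))⟩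

theorem rep_injective (hsimple : IsCongruenceSimple S)
    (hfaith : ∀ y : S, (∀ s, s * y = ⊥) → y = ⊥) (hx : x ≠ ⊥) :
    Function.Injective (rep.{u, w} x) := by
  obtain ⟨s, hs⟩ := not_forall.1 (mt (hfaith x) hx)
  obtain ⟨t, ht⟩ := not_forall.1 (mt (hfaith (s * x)) hs)
  refine hsimple.injective_of_ne (rep x) (a := t) (b := ⊥) fun h => ht ?_
  rw [← mul_assoc, ← mk_eq_bot_iff.{u, w} hfaith, ← rep_mk, h, rep_mk, AbsorbingBot.bot_mul, mk_bot]

theorem isDenseRep_rep (hsimple : IsCongruenceSimple S)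
    (hfaith : ∀ y : S, (∀ s, s * y = ⊥) → y = ⊥) (hx : x ≠ ⊥)
    (hmin : ∀ y : S, y ≠ ⊥ → (Set.range fun s => leftAnn.{u, w} (s * x)).ncard ≤
      (Set.range fun s => leftAnn.{u, w} (s * y)).ncard) :
    EndBot.IsDenseRep (rep.{u, w} x) where
  injective := rep_injective hsimple hfaith hx
  smallImage_subset := by
    have := nontrivial.{u, w} hfaith hx
    refine EndBot.smallImage_subset_of_transitive_of_separating (R := (rep.{u, w} x).range)
      (fun A hA B => ?_) (fun A B hAB => ?_)
    · obtain ⟨s, hs⟩ := exists_rep_eq_of_ncard_le hfaith hmin hA B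
      exact ⟨rep x s, ⟨s, rfl⟩, hs⟩
    · obtain ⟨s, hs⟩ := exists_rep_eq_bot_of_not_le hfaith hAB
      exact ⟨rep x s, ⟨s, rfl⟩, hs⟩

end Order

end AnnOrbit

end PlainSemiring

namespace IsCongruenceSimple

open PlainSemiring

variable {S : Type u} [PlainSemiring S] [SemilatticeSup S] [OrderBot S] [AbsorbingBot S]

theorem eq_bot_of_forall_mul_eq_bot (hS : IsCongruenceSimple S) (hmul : ∃ a b : S, a * b ≠ ⊥)
    (y : S) (hy : ∀ s, s * y = ⊥) : y = ⊥ := by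
  obtain ⟨a, b, hab⟩ := hmul
  exact hS.eq_of_forall_mul_eq ⟨a, b, ⊥, hab.trans_eq (AbsorbingBot.mul_bot a).symm⟩
    fun s => (hy s).trans (AbsorbingBot.mul_bot s).symm

theorem exists_isDenseRep [AddEqSup S] [Finite S] (hS : IsCongruenceSimple S)
    (hmul : ∃ a b : S, a * b ≠ ⊥) :
    ∃ (L : Type w) (_ : Lattice L) (_ : OrderBot L) (_ : Finite L) (_ : Nontrivial L)
      (φ : Hom S (EndBot L)), EndBot.IsDenseRep φ := by
  have hfaith := hS.eq_bot_of_forall_mul_eq_bot hmul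
  have := hS.nontrivial
  obtain ⟨x, hx, hmin⟩ := Set.exists_min_image {y : S | y ≠ ⊥}
    (fun y => (Set.range fun s => leftAnn.{u, w} (s * y)).ncard) (Set.toFinite _) (exists_ne ⊥)
  exact ⟨AnnOrbit.{u, w} x, inferInstance, inferInstance, inferInstance,
    AnnOrbit.nontrivial hfaith hx, AnnOrbit.rep.{u, w} x, AnnOrbit.isDenseRep_rep hS hfaith hx hmin⟩

end IsCongruenceSimple

theorem mainTheorem5 {S : Type*} [PlainSemiring S] [Nonempty S] [Finite S]
    (hS : ∀ a : S, a + a = a) (n : ℕ) (hn : 2 ≤ n) :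
    IsCongruenceSimple (SqMat n S) ↔
      ∃ (L : Type*) (_ : Lattice L) (_ : OrderBot L) (_ : Finite L) (_ : Nontrivial L)
        (R : PlainSubsemiring (EndBot L)),
        EndBot.smallImage L ⊆ (R : Set (EndBot L)) ∧ Nonempty (S ≃+* R) := by
  obtain ⟨m, rfl⟩ := Nat.exists_eq_add_of_le' hn
  constructor
  · intro h
    let := PlainSemiring.semilatticeSup hS
    have : AddEqSup S := ⟨fun _ _ => rfl⟩
    obtain ⟨z, hz⟩ := SqMat.exists_isBot h
    let : OrderBot S := { bot := z, bot_le := hz }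
    have := SqMat.absorbingBot h
    have hsimple := SqMat.isCongruenceSimple_entries h
    obtain ⟨L, _, _, hfin, hnt, φ, hφ⟩ := hsimple.exists_isDenseRep (SqMat.exists_mul_ne_bot h)
    exact ⟨L, _, _, hfin, hnt, EndBot.IsDenseRep.exists_iff_exists_subsemiring.1 ⟨φ, hφ⟩⟩
  · rintro ⟨L, _, _, _, _, hR⟩
    obtain ⟨φ, hφ⟩ := EndBot.IsDenseRep.exists_iff_exists_subsemiring.2 hR
    exact (hφ.mapMatrix (m + 1)).isCongruenceSimple
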